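/- Let $I,n,m$ be integers with $I\ge 2$, $n\ge 1$, $m\ge 1$. Identify an $(n,m)$-bit string $x=(x_{n-1},\dots,x_0,x_{-1},\dots,x_{-m})\in\{0,1\}^{n+m}$ with the dyadic number $\mathrm D_{n,m}(x)=-x_{n-1}2^{n-1}+\sum_{k=-m}^{n-2}x_k2^k$ (two's complement); $\mathrm D_{n,m}$ is a bijection from $\{0,1\}^{n+m}$ onto $[-2^{n-1},2^{n-1}-2^{-m}]\cap 2^{-m}\mathbb Z$, and its inverse is the encoder $\mathrm E_{n,m}$, which determines the sign bit and then greedily the bits $x_{n-2},\dots,x_{-m}$. For bit strings $i_1,\dots,i_I\in\{0,1\}^{n+m}$ put $$\mathrm M_{I,n,m}(i_1,\dots,i_I)=\mathrm E_{n,m}\big(\max\{\mathrm D_{n,m}(i_1),\dots,\mathrm D_{n,m}(i_I)\}\big).$$ The elementary gates are the one-qubit gates $X$, $Y$, $Z$, $H$, $S$, $T$, $R_x(\theta)$, $R_y(\theta)$, $R_z(\theta)$ with $\theta\in(0,4\pi)$, $P(\phi)=\mathrm{diag}(1,e^{\mathrm i\phi})$ with $\phi\in(0,2\pi)$, and the two-qubit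 gates CNOT (first qubit control, second qubit target) and SWAP. A quantum circuit on $N$ qubits is a finite product $\prod_{l=1}^{L}(G_{l,1}\otimes\cdots\otimes G_{l,n_l})$ of $2^N\times 2^N$ matrices in which every $G_{l,j}$ is an elementary gate or the one-qubit identity; the number of elementary gates it uses is the number of pairs $(l,j)$ for which $G_{l,j}$ is an elementary gate. Then there is a quantum circuit $\mathcal Q$ on $N=I(n+m)+(I-1)(n+m+4)$ qubits, using at most $657\,I^2(n+m+1)^3$ elementary gates, such that for all $i_1,\dots,i_I\in\{0,1\}^{n+m}$ there is a normalized state $|\mathrm{anc}\rangle$ of $(I-2)(n+m)+4(I-1)$ qubits (which may depend on $i_1,\dots,i_I$) with $$\mathcal Q\,|i_1\rangle_{n+m}\cdots|i_I\rangle_{n+m}|0\rangle_{(I-1)(n+m+4)}=|i_1\rangle_{n+m}\cdots|i_I\rangle_{n+m}\,|\mathrm{anc}\rangle_{(I-2)(n+m)+4(I-1)}\,|\mathrm M_{I,n,m}(i_1,\dots,i_I)\rangle_{n+m}.$$ -/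

import Mathlib

namespace QuantumMax

noncomputable section

/-- Strings of `n` bits. Position `0` is the leftmost bit (qubit). -/
abbrev Bits (n : ℕ) : Type := Fin n → Fin 2

/-- Vectors of the `n`-qubit space `(ℂ²)^{⊗ n}`, given by their amplitudes in the
computational basis. -/
abbrev State (n : ℕ) : Type := Bits n → ℂ

/-- `2ⁿ × 2ⁿ` complex matrices, indexed by the computational basis. -/
abbrev Operator (n : ℕ) : Type := Matrix (Bits n) (Bits n) ℂ

/-- The computational basis vector `|i⟩`. -/
def ket {n : ℕ} (i : Bits n) : State n := Pi.single i 1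

/-- Normalized vectors: `⟨ψ|ψ⟩ = 1`. -/
def IsNormalized {n : ℕ} (ψ : State n) : Prop := ∑ x : Bits n, ‖ψ x‖ ^ 2 = 1

/-- The first `p` bits of a string of `p + q` bits. -/
def leftBits {p q : ℕ} (x : Bits (p + q)) : Bits p := fun j => x (Fin.castAdd q j)

/-- The last `q` bits of a string of `p + q` bits. -/
def rightBits {p q : ℕ} (x : Bits (p + q)) : Bits q := fun j => x (Fin.natAdd p j)

/-- The tensor product `ψ ⊗ φ` of two states. -/
def tensorState {p q : ℕ} (ψ : State p) (φ : State q) : State (p + q) :=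
  fun x => ψ (leftBits x) * φ (rightBits x)

/-- The Kronecker product `A ⊗ B` of two operators. -/
def tensorOp {p q : ℕ} (A : Operator p) (B : Operator q) : Operator (p + q) :=
  Matrix.of fun x y => A (leftBits x) (leftBits y) * B (rightBits x) (rightBits y)

/-- Transport of a state along an equality of the numbers of qubits. -/
def castState {p q : ℕ} (h : p = q) (ψ : State p) : State q :=
  fun x => ψ fun j => x (Fin.cast h j)

/-! ### Elementary gates -/

/-- A `2 × 2` matrix as an operator on one qubit. -/
def oneQubit (A : Matrix (Fin 2) (Fin 2) ℂ) : Operator 1 :=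
  Matrix.of fun x y => A (x 0) (y 0)

def gateX : Matrix (Fin 2) (Fin 2) ℂ := !![0, 1; 1, 0]

def gateY : Matrix (Fin 2) (Fin 2) ℂ := !![0, -Complex.I; Complex.I, 0]

def gateZ : Matrix (Fin 2) (Fin 2) ℂ := !![1, 0; 0, -1]

def gateH : Matrix (Fin 2) (Fin 2) ℂ := ((Real.sqrt 2 : ℝ) : ℂ)⁻¹ • !![1, 1; 1, -1]

/-- The phase shift gate `P(φ)`. -/
def gateP (φ : ℝ) : Matrix (Fin 2) (Fin 2) ℂ :=
  !![1, 0; 0, Complex.exp (Complex.I * (φ : ℂ))]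

def gateS : Matrix (Fin 2) (Fin 2) ℂ := gateP (Real.pi / 2)

def gateT : Matrix (Fin 2) (Fin 2) ℂ := gateP (Real.pi / 4)

def gateRx (θ : ℝ) : Matrix (Fin 2) (Fin 2) ℂ :=
  !![(Real.cos (θ / 2) : ℂ), -Complex.I * (Real.sin (θ / 2) : ℂ);
    -Complex.I * (Real.sin (θ / 2) : ℂ), (Real.cos (θ / 2) : ℂ)]

def gateRy (θ : ℝ) : Matrix (Fin 2) (Fin 2) ℂ :=
  !![(Real.cos (θ / 2) : ℂ), -(Real.sin (θ / 2) : ℂ);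
    (Real.sin (θ / 2) : ℂ), (Real.cos (θ / 2) : ℂ)]

def gateRz (θ : ℝ) : Matrix (Fin 2) (Fin 2) ℂ :=
  !![Complex.exp (-Complex.I * (θ : ℂ) / 2), 0;
    0, Complex.exp (Complex.I * (θ : ℂ) / 2)]

/-- The controlled-NOT gate `|a⟩|b⟩ ↦ |a⟩|a + b mod 2⟩`: the first qubit is the control, the
second one the target. -/
def gateCNOT : Operator 2 :=
  Matrix.of fun x y => if x = ![y 0, y 0 + y 1] then 1 else 0

/-- The swap gate `|a⟩|b⟩ ↦ |b⟩|a⟩`. -/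
def gateSWAP : Operator 2 :=
  Matrix.of fun x y => if x = ![y 1, y 0] then 1 else 0

/-- The set of elementary gates: `IsElementaryGate k G` says that `G` is an elementary gate
acting on `k` qubits (`k = 1` or `k = 2`). -/
inductive IsElementaryGate : (k : ℕ) → Operator k → Prop
  | X : IsElementaryGate 1 (oneQubit gateX)
  | Y : IsElementaryGate 1 (oneQubit gateY)
  | Z : IsElementaryGate 1 (oneQubit gateZ)
  | H : IsElementaryGate 1 (oneQubit gateH)
  | S : IsElementaryGate 1 (oneQubit gateS)
  | T : IsElementaryGate 1 (oneQubit gateT)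
  | Rx (θ : ℝ) (hθ : θ ∈ Set.Ioo 0 (4 * Real.pi)) : IsElementaryGate 1 (oneQubit (gateRx θ))
  | Ry (θ : ℝ) (hθ : θ ∈ Set.Ioo 0 (4 * Real.pi)) : IsElementaryGate 1 (oneQubit (gateRy θ))
  | Rz (θ : ℝ) (hθ : θ ∈ Set.Ioo 0 (4 * Real.pi)) : IsElementaryGate 1 (oneQubit (gateRz θ))
  | P (φ : ℝ) (hφ : φ ∈ Set.Ioo 0 (2 * Real.pi)) : IsElementaryGate 1 (oneQubit (gateP φ))
  | CNOT : IsElementaryGate 2 gateCNOT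
  | SWAP : IsElementaryGate 2 gateSWAP

/-! ### Quantum circuits -/

/-- `IsLayer n A M`: the operator `A` on `n` qubits is a tensor product `G₁ ⊗ G₂ ⊗ ⋯` of
elementary gates and of one-qubit identities (wires), of which exactly `M` factors are elementary
gates. -/
inductive IsLayer : (n : ℕ) → Operator n → ℕ → Prop
  | empty : IsLayer 0 1 0
  | wire {n M : ℕ} {A : Operator n} (hA : IsLayer n A M) :
      IsLayer (1 + n) (tensorOp (1 : Operator 1) A) M
  | gate {k n M : ℕ} {G : Operator k} {A : Operator n} (hG : IsElementaryGate k G)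
      (hA : IsLayer n A M) : IsLayer (k + n) (tensorOp G A) (M + 1)

/-- `IsQuantumCircuit n Q M`: the operator `Q` on `n` qubits is a product of finitely many (at
least one) layers which contain `M` elementary gates in total, that is, `Q` is a quantum circuit on
`n` qubits constructed from `M` elementary gates. -/
inductive IsQuantumCircuit (n : ℕ) : Operator n → ℕ → Prop
  | layer {A : Operator n} {M : ℕ} (hA : IsLayer n A M) : IsQuantumCircuit n A M
  | comp {A Q : Operator n} {M M' : ℕ} (hA : IsLayer n A M) (hQ : IsQuantumCircuit n Q M') :
      IsQuantumCircuit n (A * Q) (M + M')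

/-! ### The two's complement representation

An `(n, m)`-bit string `((x_{n-1}, …, x_0), (x_{-1}, …, x_{-m}))` is a string of `n + m` bits;
the bit `x_k`, of weight `2 ^ k`, stands at position `n - 1 - k`. -/

/-- The decoder `x ↦ - x_{n-1} 2^{n-1} + ∑_{k = -m}^{n-2} x_k 2^k`. -/
def decode (n m : ℕ) (x : Bits (n + m)) : ℚ :=
  ∑ p : Fin (n + m),
    (if (p : ℕ) = 0 then (-1 : ℚ) else 1) * ((x p : ℕ) : ℚ) * (2 : ℚ) ^ ((n : ℤ) - 1 - (p : ℤ))

/-- The value `- x_{n-1} 2^{n-1} + ∑_{j = n-1-p}^{n-2} x_j 2^j` of the bits at the positions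
`0, …, p` that the encoder has chosen for `y`. -/
def encodePrefix (n : ℕ) (y : ℚ) : ℕ → ℚ
  | 0 => if y < 0 then -(2 : ℚ) ^ ((n : ℤ) - 1) else 0
  | p + 1 =>
      if encodePrefix n y p + (2 : ℚ) ^ ((n : ℤ) - 1 - ((p + 1 : ℕ) : ℤ)) ≤ y then
        encodePrefix n y p + (2 : ℚ) ^ ((n : ℤ) - 1 - ((p + 1 : ℕ) : ℤ))
      else encodePrefix n y p

/-- The bit at position `p` that the encoder chooses for `y`. -/
def encodeBit (n : ℕ) (y : ℚ) : ℕ → Fin 2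
  | 0 => if y < 0 then 1 else 0
  | p + 1 =>
      if encodePrefix n y p + (2 : ℚ) ^ ((n : ℤ) - 1 - ((p + 1 : ℕ) : ℤ)) ≤ y then 1 else 0

/-- The encoder, meant for `y ∈ [-2^{n-1}, 2^{n-1} - 2^{-m}] ∩ 2^{-m} ℤ`. -/
def encode (n m : ℕ) (y : ℚ) : Bits (n + m) := fun p => encodeBit n y p

/-- The encoding of the maximum of `I ≥ 1` encoded numbers. -/
def maxString {I n m : ℕ} (hI : 0 < I) (i : Fin I → Bits (n + m)) : Bits (n + m) :=
  encode n m (Finset.univ.sup' ⟨⟨0, hI⟩, Finset.mem_univ _⟩ fun l => decode n m (i l))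

/-! ### Registers -/

/-- The concatenation of `I` registers of `w` bits each. -/
def concat {I w : ℕ} (i : Fin I → Bits w) : Bits (I * w) := fun p => i p.divNat p.modNat

/-- The `I` inputs, the ancillas and the output register fill up the `N` qubits. -/
theorem width_eq {I : ℕ} (hI : 2 ≤ I) (w : ℕ) :
    I * w + (((I - 2) * w + 4 * (I - 1)) + w) = I * w + (I - 1) * (w + 4) := by
  obtain ⟨k, rfl⟩ := Nat.exists_eq_add_of_le hI
  have h1 : 2 + k - 2 = k := by omega
  have h2 : 2 + k - 1 = k + 1 := by omega
  rw [h1, h2]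
  ring

end

end QuantumMax

open QuantumMax

namespace QuantumMax

/-! ### Layers with a single gate -/

/-! The circuit is a reversible classical program. It acts on basis states only, so each subcircuit
is described by the map it induces on bit strings (`Implements`); strings are infinite, so that
wires are plain natural numbers, and phases appear only on the way to the Toffoli gate.

A CNOT between distant wires is an adjacent CNOT conjugated by swaps, at most `2 * N` gates
(`implements_cnot`); with seven phase gates and two Hadamards, six of them make a Toffoli gate
(`implements_toffoli`). These two gates write any quadratic polynomial over 𝔽₂ in the bits of other
wires, in particular a comparison carry and a two-way selection.

One comparison (`exists_implements_selection`) computes the carries from the lowest bit up, copies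
the last one to a flag, undoes the carries, and uses the cleaned wires again to hold the selected
number. This reuse keeps a comparison within `n + m + 4` fresh wires. Two's complement numbers
compare like unsigned ones once their sign bits are exchanged (`decode_lt_iff_carry`). Then `I - 1`
comparisons, each in its own block, maintain a running maximum (`exists_implements_running_max`).
The last block ends with the maximal input string itself, which is the required encoding by
`encode_decode`; everything between inputs and output is a basis state and serves as the ancilla. -/

theorem tensorOp_one (p q : ℕ) : tensorOp (1 : Operator p) (1 : Operator q) = 1 := by
  ext x y
  simp only [tensorOp, Matrix.of_apply, Matrix.one_apply]
  by_cases h : x = y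
  · subst h; simp
  · rw [if_neg h]
    by_cases h1 : leftBits x = leftBits y
    · rw [if_neg (c := rightBits x = rightBits y), mul_zero]
      intro h2
      apply h
      ext1 j
      refine Fin.addCases (fun j => ?_) (fun j => ?_) j
      · exact congrFun h1 j
      · exact congrFun h2 j
    · rw [if_neg h1, zero_mul]

theorem isLayer_one (n : ℕ) : IsLayer n 1 0 := by
  induction n with
  | zero => exact .empty
  | succ n ih =>
    rw [Nat.add_comm, ← tensorOp_one]
    exact .wire ih

/-- A gate on the qubits `p, …, p + k - 1`, with wires elsewhere. -/
theorem exists_layer_gate {k : ℕ} {G : Operator k} (hG : IsElementaryGate k G) (p : ℕ) :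
    ∀ (N : ℕ) (h : p + k ≤ N), ∃ A : Operator N, IsLayer N A 1 ∧
      ∀ x y, A x y =
        if ∀ j : Fin N, ((j : ℕ) < p ∨ p + k ≤ j) → x j = y j then
          G (fun t => x ⟨p + t, by omega⟩) (fun t => y ⟨p + t, by omega⟩)
        else 0 := by
  induction p with
  | zero =>
    intro N h
    obtain ⟨r, rfl⟩ : ∃ r, N = k + r := ⟨N - k, by omega⟩
    refine ⟨tensorOp G 1, .gate hG (isLayer_one r), fun x y => ?_⟩
    simp only [tensorOp, Matrix.of_apply, Matrix.one_apply]
    have hiff : rightBits x = rightBits y ↔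
        ∀ j : Fin (k + r), ((j : ℕ) < 0 ∨ 0 + k ≤ j) → x j = y j := by
      constructor
      · intro hr j hj
        have := congrFun hr ⟨j - k, by omega⟩
        have e2 : Fin.natAdd k (⟨j - k, by omega⟩ : Fin r) = j := by
          ext; simp; omega
        simpa [rightBits, e2] using this
      · intro hr
        ext1 j
        exact hr _ (by simp)
    by_cases hh : rightBits x = rightBits y
    · rw [if_pos hh, if_pos (hiff.1 hh), mul_one]
      congr 1 <;> ext1 t <;> simp only [leftBits] <;> congr 1 <;> ext <;> simp
    · rw [if_neg hh, if_neg (fun h' => hh (hiff.2 h')), mul_zero]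
  | succ p ih =>
    intro N h
    obtain ⟨N, rfl⟩ : ∃ N', N = 1 + N' := ⟨N - 1, by omega⟩
    obtain ⟨A, hA, hAe⟩ := ih N (by omega)
    refine ⟨tensorOp 1 A, .wire hA, fun x y => ?_⟩
    simp only [tensorOp, Matrix.of_apply, Matrix.one_apply, hAe]
    by_cases hl : leftBits x = leftBits y
    · rw [if_pos hl, one_mul]
      have hiff : (∀ j : Fin N, ((j : ℕ) < p ∨ p + k ≤ j) → rightBits x j = rightBits y j) ↔
          ∀ j : Fin (1 + N), ((j : ℕ) < p + 1 ∨ p + 1 + k ≤ j) → x j = y j := by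
        constructor
        · intro hr j
          refine Fin.addCases (fun j _ => congrFun hl j) (fun j hj => hr j ?_) j
          simp at hj
          omega
        · intro hr j hj
          refine hr _ ?_
          simp
          omega
      refine if_congr hiff ?_ rfl
      congr 1 <;> ext1 t <;> simp only [rightBits] <;> congr 1 <;> ext <;> simp only [Fin.val_natAdd] <;>
        omega
    · rw [if_neg hl, zero_mul, if_neg]
      intro h'
      apply hl
      ext1 j
      exact h' _ (Or.inl (by simp))

theorem IsQuantumCircuit.mul {n M M' : ℕ} {A B : Operator n} (hA : IsQuantumCircuit n A M)
    (hB : IsQuantumCircuit n B M') : IsQuantumCircuit n (A * B) (M + M') := by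
  induction hA with
  | layer hA => exact .comp hA hB
  | comp hA _ ih => rw [mul_assoc, add_assoc]; exact .comp hA ih

/-! ### Classical states -/

/-- The first `N` bits of an infinite string. -/
def restrict (N : ℕ) (x : ℕ → Fin 2) : Bits N := fun j => x j

@[simp]
theorem restrict_apply (N : ℕ) (x : ℕ → Fin 2) (j : Fin N) : restrict N x j = x j := rfl

open Function (update)

theorem mulVec_ket {N : ℕ} (A : Operator N) (y : Bits N) :
    A.mulVec (ket y) = fun x => A x y := by
  ext x
  simp [ket]

theorem ket_apply {N : ℕ} (x y : Bits N) : ket y x = if x = y then 1 else 0 := by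
  simp [ket, Pi.single_apply]

theorem restrict_eq_update {N : ℕ} (x : Bits N) (y : ℕ → Fin 2) (p : ℕ) (hp : p < N) (u : Fin 2) :
    x = restrict N (update y p u) ↔
      (∀ j : Fin N, ((j : ℕ) < p ∨ p + 1 ≤ j) → x j = y j) ∧ x ⟨p, hp⟩ = u := by
  constructor
  · rintro rfl
    refine ⟨fun j hj => ?_, by simp [restrict]⟩
    have : (j : ℕ) ≠ p := by omega
    simp [restrict, this]
  · rintro ⟨h1, h2⟩
    ext1 j
    by_cases hj : (j : ℕ) = p
    · subst hj; simpa [restrict] using h2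
    · simp only [restrict, Function.update_of_ne hj]
      exact h1 j (by omega)

theorem exists_layer_oneQubit {U : Matrix (Fin 2) (Fin 2) ℂ}
    (hU : IsElementaryGate 1 (oneQubit U)) {N p : ℕ} (hp : p < N) :
    ∃ A : Operator N, IsLayer N A 1 ∧ ∀ y : ℕ → Fin 2, A.mulVec (ket (restrict N y)) =
      U 0 (y p) • ket (restrict N (update y p 0)) +
        U 1 (y p) • ket (restrict N (update y p 1)) := by
  obtain ⟨A, hA, hAe⟩ := exists_layer_gate hU p N (by omega)
  refine ⟨A, hA, fun y => ?_⟩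
  rw [mulVec_ket]
  ext x
  simp only [hAe, Pi.add_apply, Pi.smul_apply, ket_apply, restrict_eq_update _ _ p hp, oneQubit,
    Matrix.of_apply, smul_eq_mul]
  have h01 : x ⟨p, hp⟩ = 0 ∨ x ⟨p, hp⟩ = 1 := by
    generalize x ⟨p, hp⟩ = u; revert u; decide
  by_cases h : ∀ j : Fin N, ((j : ℕ) < p ∨ p + 1 ≤ j) → x j = y j
  · have h' : ∀ j : Fin N, ((j : ℕ) < p ∨ p + 1 ≤ j) → x j = restrict N y j := h
    rw [if_pos h']
    simp only [eq_true h, true_and]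
    rcases h01 with h0 | h0 <;> simp [h0]
  · have h' : ¬ ∀ j : Fin N, ((j : ℕ) < p ∨ p + 1 ≤ j) → x j = restrict N y j := h
    rw [if_neg h']
    simp only [eq_false h, false_and, if_false, mul_zero, add_zero]

theorem exists_layer_twoQubit {g : Fin 2 → Fin 2 → Fin 2 × Fin 2}
    (hg : IsElementaryGate 2 (Matrix.of fun x y =>
      if x = ![(g (y 0) (y 1)).1, (g (y 0) (y 1)).2] then 1 else 0)) {N p : ℕ} (hp : p + 1 < N) :
    ∃ A : Operator N, IsLayer N A 1 ∧ ∀ y : ℕ → Fin 2, A.mulVec (ket (restrict N y)) =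
      ket (restrict N (update (update y p (g (y p) (y (p + 1))).1) (p + 1)
        (g (y p) (y (p + 1))).2)) := by
  obtain ⟨A, hA, hAe⟩ := exists_layer_gate hg p N (by omega)
  refine ⟨A, hA, fun y => ?_⟩
  rw [mulVec_ket]
  ext x
  simp only [hAe, ket_apply, Matrix.of_apply, restrict_apply, Fin.val_zero, Fin.val_one, add_zero]
  generalize g (y p) (y (p + 1)) = u
  rw [← ite_and]
  refine if_congr ⟨?_, ?_⟩ rfl rfl
  · rintro ⟨h1, h2⟩
    ext1 j
    by_cases hj : (j : ℕ) = p
    · rw [restrict_apply]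
      have := congrFun h2 0
      simp only [Fin.val_zero, add_zero, Matrix.cons_val_zero] at this
      rw [Function.update_of_ne (by omega), hj, Function.update_self, ← this]
      congr 1; ext; exact hj
    · by_cases hj' : (j : ℕ) = p + 1
      · rw [restrict_apply]
        have := congrFun h2 1
        simp only [Fin.val_one, Matrix.cons_val_one, Matrix.cons_val_fin_one] at this
        rw [hj', Function.update_self, ← this]
        congr 1; ext; exact hj'
      · rw [restrict_apply, Function.update_of_ne hj', Function.update_of_ne hj]
        exact h1 j (by omega)
  · rintro rfl
    refine ⟨fun j hj => ?_, ?_⟩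
    · rw [restrict_apply, Function.update_of_ne (by omega), Function.update_of_ne (by omega)]
    · ext1 t
      fin_cases t <;> simp

/-! ### Circuits that permute the computational basis up to phases -/

/-- `F`, with phases `φ`, is implemented on `N` qubits by a circuit with at most `M` gates. -/
def Implements (N M : ℕ) (φ : (ℕ → Fin 2) → ℂ) (F : (ℕ → Fin 2) → ℕ → Fin 2) : Prop :=
  ∃ (Q : Operator N) (M' : ℕ), IsQuantumCircuit N Q M' ∧ M' ≤ M ∧
    ∀ x, Q.mulVec (ket (restrict N x)) = φ x • ket (restrict N (F x))

theorem Implements.id (N : ℕ) : Implements N 0 1 id :=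
  ⟨1, 0, .layer (isLayer_one N), le_rfl, by simp⟩

theorem Implements.mono {N M M' : ℕ} {φ F} (h : Implements N M φ F) (hM : M ≤ M') :
    Implements N M' φ F := by
  obtain ⟨Q, K, h1, h2, h3⟩ := h
  exact ⟨Q, K, h1, h2.trans hM, h3⟩

/-- First `F`, then `F'`. -/
theorem Implements.andThen {N M M' : ℕ} {φ φ' F F'} (h : Implements N M φ F)
    (h' : Implements N M' φ' F') :
    Implements N (M + M') (fun x => φ x * φ' (F x)) (fun x => F' (F x)) := by
  obtain ⟨Q, K, h1, h2, h3⟩ := h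
  obtain ⟨Q', K', h1', h2', h3'⟩ := h'
  refine ⟨Q' * Q, K' + K, h1'.mul h1, by omega, fun x => ?_⟩
  rw [← Matrix.mulVec_mulVec, h3, Matrix.mulVec_smul, h3', smul_smul]

theorem Implements.comp {N M M' : ℕ} {F F'} (h' : Implements N M' 1 F')
    (h : Implements N M 1 F) : Implements N (M + M') 1 (F' ∘ F) := by
  have := h.andThen h'
  simp only [Pi.one_apply, mul_one] at this
  exact this

/-- Add the bit `g x` to the wire `t`. -/
def xorInto (t : ℕ) (g : (ℕ → Fin 2) → Fin 2) (x : ℕ → Fin 2) : ℕ → Fin 2 :=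
  update x t (x t + g x)

theorem implements_phase {N j : ℕ} (hj : j < N) {θ : ℝ} (hθ : θ ∈ Set.Ioo 0 (2 * Real.pi)) :
    Implements N 1 (fun x => if x j = 1 then Complex.exp (Complex.I * θ) else 1) (fun x => x) := by
  obtain ⟨A, hA, h⟩ := exists_layer_oneQubit (.P θ hθ) hj
  refine ⟨A, 1, .layer hA, le_rfl, fun x => ?_⟩
  rw [h]
  have h01 : x j = 0 ∨ x j = 1 := by
    generalize x j = u; revert u; decide
  have hu : update x j (x j) = x := Function.update_eq_self j x
  rcases h01 with h0 | h0 <;> rw [h0] at hu <;> simp [gateP, h0, hu]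

theorem implements_swap_adjacent {N p : ℕ} (hp : p + 1 < N) :
    Implements N 1 1 (fun x => x ∘ Equiv.swap p (p + 1)) := by
  obtain ⟨A, hA, h⟩ := exists_layer_twoQubit (g := fun a b => (b, a)) .SWAP hp
  refine ⟨A, 1, .layer hA, le_rfl, fun x => ?_⟩
  rw [h, Pi.one_apply, one_smul]
  congr 2
  ext1 j
  simp only [Function.update_apply, Function.comp_apply, Equiv.swap_apply_def]
  split_ifs <;> simp_all

theorem implements_cnot_adjacent {N p : ℕ} (hp : p + 1 < N) :
    Implements N 1 1 (xorInto (p + 1) fun x => x p) := by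
  obtain ⟨A, hA, h⟩ := exists_layer_twoQubit (g := fun a b => (a, a + b)) .CNOT hp
  refine ⟨A, 1, .layer hA, le_rfl, fun x => ?_⟩
  rw [h, Pi.one_apply, one_smul]
  simp only [Function.update_eq_self, xorInto, add_comm]

/-- Relabelling wires by an involution and back moves both control and target; this is what lets
swaps transport a CNOT. -/
theorem xorInto_conj_perm (σ : Equiv.Perm ℕ) (hσ : ∀ j, σ (σ j) = j) (i j : ℕ) (x : ℕ → Fin 2) :
    xorInto j (fun x => x i) (x ∘ σ) ∘ σ = xorInto (σ j) (fun x => x (σ i)) x := by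
  ext1 l
  simp only [xorInto, Function.update_apply, Function.comp_apply]
  by_cases h : l = σ j
  · subst h; simp [hσ]
  · rw [if_neg h, if_neg (fun h' => h (by rw [← h', hσ])), hσ]

theorem Implements.cnot_conj {N M i j p : ℕ} (hp : p + 1 < N)
    (h : Implements N M 1 (xorInto j fun x => x i)) :
    Implements N (M + 2) 1 (xorInto (Equiv.swap p (p + 1) j)
      fun x => x (Equiv.swap p (p + 1) i)) := by
  have hs := implements_swap_adjacent hp
  have := ((hs.comp h).comp hs).mono (M' := M + 2) (by omega)
  convert this using 1
  ext1 x
  exact (xorInto_conj_perm _ (Equiv.swap_apply_self _ _) i j x).symm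

theorem implements_cnot_down (N i d : ℕ) (h : i + 1 + d < N) :
    Implements N (1 + 2 * d) 1 (xorInto (i + 1 + d) fun x => x i) := by
  induction d with
  | zero => exact implements_cnot_adjacent h
  | succ d ih =>
    have := (ih (by omega)).cnot_conj (p := i + 1 + d) (by omega)
    rw [Equiv.swap_apply_left, Equiv.swap_apply_of_ne_of_ne (by omega) (by omega)] at this
    exact this

theorem implements_cnot_up (N i d : ℕ) (h : i + 1 + d < N) :
    Implements N (3 + 2 * d) 1 (xorInto i fun x => x (i + 1 + d)) := by
  induction d with
  | zero =>
    -- Swapping the two wires of the CNOT itself exchanges control and target.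
    have := (implements_cnot_adjacent h).cnot_conj (p := i) h
    rwa [Equiv.swap_apply_left, Equiv.swap_apply_right] at this
  | succ d ih =>
    have := (ih (by omega)).cnot_conj (p := i + 1 + d) (by omega)
    rw [Equiv.swap_apply_left, Equiv.swap_apply_of_ne_of_ne (by omega) (by omega)] at this
    exact this

theorem implements_cnot {N i j : ℕ} (hi : i < N) (hj : j < N) (hij : i ≠ j) :
    Implements N (2 * N) 1 (xorInto j fun x => x i) := by
  rcases lt_or_gt_of_ne hij with h | h
  · obtain ⟨d, rfl⟩ := Nat.exists_eq_add_of_le h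
    exact (implements_cnot_down N i d hj).mono (by omega)
  · obtain ⟨d, rfl⟩ := Nat.exists_eq_add_of_le h
    exact (implements_cnot_up N j d hi).mono (by omega)

/-! ### The Toffoli gate -/

theorem exp_pi_div_four_pow_four : Complex.exp (Complex.I * (Real.pi / 4 : ℝ)) ^ 4 = -1 := by
  rw [← Complex.exp_nat_mul, ← Complex.exp_pi_mul_I]
  congr 1
  push_cast
  ring

theorem exp_seven_pi_div_four : Complex.exp (Complex.I * (7 * Real.pi / 4 : ℝ)) =
    Complex.exp (Complex.I * (Real.pi / 4 : ℝ)) ^ 7 := by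
  rw [← Complex.exp_nat_mul]
  congr 1
  push_cast
  ring

/-- For bits, `4abt = a + b + t - (a⊕b) - (a⊕t) - (b⊕t) + (a⊕b⊕t)`. With `ω = exp(iπ/4)` and `ω ^ 4
= -1`, the sign is a product of seven phases `ω` or `ω⁻¹`, each applied while a wire holds the
corresponding parity. -/
theorem implements_ccz {N a b t : ℕ} (ha : a < N) (hb : b < N) (ht : t < N) (hab : a ≠ b)
    (hat : a ≠ t) (hbt : b ≠ t) :
    Implements N (12 * N + 7) (fun x => if x a = 1 ∧ x b = 1 ∧ x t = 1 then -1 else 1)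
      (fun x => x) := by
  have hpi := Real.pi_pos
  have hT : ∀ j < N, _ := fun j hj => implements_phase (N := N) (j := j) hj (θ := Real.pi / 4)
    ⟨by positivity, by linarith⟩
  -- The angle `-π/4` is not admissible for `P`, so `ω⁻¹` is realized as `ω ^ 7`.
  have hT' : ∀ j < N, _ := fun j hj => implements_phase (N := N) (j := j) hj
    (θ := 7 * Real.pi / 4) ⟨by positivity, by linarith⟩
  rw [exp_seven_pi_div_four] at hT'
  have h4 := exp_pi_div_four_pow_four
  generalize Complex.exp (Complex.I * (Real.pi / 4 : ℝ)) = ω at hT hT' h4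
  have h8 : ω ^ 8 = 1 := by
    rw [show ω ^ 8 = (ω ^ 4) ^ 2 by ring, h4]; norm_num
  have cbt := implements_cnot hb ht hbt
  have cat := implements_cnot ha ht hat
  have cab := implements_cnot ha hb hab
  have key := ((((((((((((cbt.andThen (hT' t ht)).andThen cat).andThen (hT t ht)).andThen
    cbt).andThen (hT' t ht)).andThen cat).andThen (hT t ht)).andThen (hT b hb)).andThen
    cab).andThen (hT' b hb)).andThen cab).andThen (hT a ha)).mono (M' := 12 * N + 7) (by omega)
  have two : ∀ u : Fin 2, u = 0 ∨ u = 1 := by decide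
  have e11 : (1 + 1 : Fin 2) = 0 := rfl
  convert key using 1
  · ext1 x
    rcases two (x a) with h1 | h1 <;> rcases two (x b) with h2 | h2 <;>
      rcases two (x t) with h3 | h3 <;>
      simp [xorInto, h1, h2, h3, hab, hat, hbt, e11] <;> grind
  · ext1 x
    ext1 l
    rcases two (x a) with h1 | h1 <;> rcases two (x b) with h2 | h2 <;>
      rcases two (x t) with h3 | h3 <;>
      simp [xorInto, Function.update_apply, h1, h2, h3, hab, hat, hbt, e11] <;> grind

/-- Conjugating by `H` on the target turns the controlled sign into a controlled bit flip, since
`HZH = X`. -/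
theorem implements_toffoli {N a b t : ℕ} (ha : a < N) (hb : b < N) (ht : t < N) (hab : a ≠ b)
    (hat : a ≠ t) (hbt : b ≠ t) :
    Implements N (12 * N + 9) 1 (xorInto t fun x => x a * x b) := by
  obtain ⟨Q, K, h1, h2, h3⟩ := implements_ccz ha hb ht hab hat hbt
  obtain ⟨A, hA, h⟩ := exists_layer_oneQubit .H ht
  refine ⟨A * (Q * A), 1 + (K + 1), (IsQuantumCircuit.layer hA).mul (h1.mul (.layer hA)),
    by omega, fun x => ?_⟩
  rw [← Matrix.mulVec_mulVec, ← Matrix.mulVec_mulVec, h]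
  simp only [Matrix.mulVec_add, Matrix.mulVec_smul, h3, h, Function.update_self,
    Function.update_idem, Function.update_of_ne hat, Function.update_of_ne hbt, Pi.one_apply,
    one_smul, xorInto]
  have two : ∀ u : Fin 2, u = 0 ∨ u = 1 := by decide
  have e11 : (1 + 1 : Fin 2) = 0 := rfl
  have hsq : ((Real.sqrt 2 : ℝ) : ℂ)⁻¹ * ((Real.sqrt 2 : ℝ) : ℂ)⁻¹ = 1 / 2 := by
    rw [← mul_inv, ← Complex.ofReal_mul, Real.mul_self_sqrt (by norm_num)]; norm_num
  have hH : gateH = ((Real.sqrt 2 : ℝ) : ℂ)⁻¹ • !![1, 1; 1, -1] := rfl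
  generalize ((Real.sqrt 2 : ℝ) : ℂ)⁻¹ = r at hsq hH
  rw [hH]
  rcases two (x a) with h1 | h1 <;> rcases two (x b) with h2 | h2 <;>
    rcases two (x t) with h3 | h3 <;> ext l <;>
    simp [h1, h2, h3, e11] <;> grind

/-! ### Reversible classical programs -/

theorem Implements.xorInto_add {N M M' t : ℕ} {g g' : (ℕ → Fin 2) → Fin 2}
    (h : Implements N M 1 (xorInto t g)) (h' : Implements N M' 1 (xorInto t g'))
    (hg' : ∀ x u, g' (update x t u) = g' x) :
    Implements N (M + M') 1 (xorInto t fun x => g x + g' x) := by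
  have := h'.comp h
  convert this using 1
  ext1 x
  simp [xorInto, hg', add_assoc]

theorem xorInto_xorInto {t : ℕ} {g : (ℕ → Fin 2) → Fin 2}
    (hg : ∀ x u, g (update x t u) = g x) (x : ℕ → Fin 2) : xorInto t g (xorInto t g x) = x := by
  have two : ∀ u v : Fin 2, u + v + v = u := by decide
  simp [xorInto, hg, two]

/-- The map `F (k - 1) ∘ ⋯ ∘ F 0`. -/
def runUp {α : Type*} (F : ℕ → α → α) : ℕ → α → α
  | 0 => id
  | k + 1 => F k ∘ runUp F k

/-- The map `F 0 ∘ ⋯ ∘ F (k - 1)`. -/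
def runDown {α : Type*} (F : ℕ → α → α) : ℕ → α → α
  | 0 => id
  | k + 1 => runDown F k ∘ F k

theorem Implements.runUp {N M : ℕ} {F : ℕ → (ℕ → Fin 2) → ℕ → Fin 2} (k : ℕ)
    (h : ∀ l < k, Implements N M 1 (F l)) : Implements N (k * M) 1 (runUp F k) := by
  induction k with
  | zero => exact (Implements.id N).mono (Nat.zero_le _)
  | succ k ih =>
    exact ((h k (by omega)).comp (ih fun l hl => h l (by omega))).mono (by rw [Nat.succ_mul])

theorem Implements.runDown {N M : ℕ} {F : ℕ → (ℕ → Fin 2) → ℕ → Fin 2} (k : ℕ)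
    (h : ∀ l < k, Implements N M 1 (F l)) : Implements N (k * M) 1 (runDown F k) := by
  induction k with
  | zero => exact (Implements.id N).mono (Nat.zero_le _)
  | succ k ih =>
    exact ((ih fun l hl => h l (by omega)).comp (h k (by omega))).mono
      (by rw [Nat.succ_mul, Nat.add_comm])

/-- Running involutions backwards undoes them, even if an uninvolved wire `f` was changed. -/
theorem runDown_update_runUp {F : ℕ → (ℕ → Fin 2) → ℕ → Fin 2} (f : ℕ) (v : Fin 2) (k : ℕ)
    (hF : ∀ l < k, ∀ x, F l (F l x) = x)
    (hf : ∀ l < k, ∀ x, F l (update x f v) = update (F l x) f v) (x : ℕ → Fin 2) :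
    runDown F k (update (runUp F k x) f v) = update x f v := by
  induction k with
  | zero => rfl
  | succ k ih =>
    simp only [runDown, runUp, Function.comp_apply]
    rw [hf k (by omega), hF k (by omega)]
    exact ih (fun l hl => hF l (by omega)) (fun l hl => hf l (by omega))

/-- The carry in the comparison of two bits, given the carry `c` of the lower bits. -/
def carryBit (a b c : Fin 2) : Fin 2 := if a = b then c else b

/-- The carry in the comparison of the low `k` bits of `α` and `β`. -/
def carry (α β : ℕ → Fin 2) : ℕ → Fin 2
  | 0 => 0
  | k + 1 => carryBit (α k) (β k) (carry α β k)

/-- The polynomial over 𝔽₂ that CNOT and Toffoli gates can add term by term. -/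
theorem carryBit_eq (a b c : Fin 2) : carryBit a b c = c + b + a * b + a * c + b * c := by
  revert a b c; decide

theorem implements_carryBit {N a b c t : ℕ} (ha : a < N) (hb : b < N) (hc : c < N) (ht : t < N)
    (hat : a ≠ t) (hbt : b ≠ t) (hct : c ≠ t) (hab : a ≠ b) (hac : a ≠ c) (hbc : b ≠ c) :
    Implements N (40 * N + 27) 1 (xorInto t fun x => carryBit (x a) (x b) (x c)) := by
  simp only [carryBit_eq]
  refine (((((implements_cnot hc ht hct).xorInto_add (implements_cnot hb ht hbt) ?_).xorInto_add
    (implements_toffoli ha hb ht hab hat hbt) ?_).xorInto_add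
    (implements_toffoli ha hc ht hac hat hct) ?_).xorInto_add
    (implements_toffoli hb hc ht hbc hbt hct) ?_).mono (by omega) <;>
    simp [Function.update_of_ne, hat, hbt, hct]

theorem implements_select {N a b f t : ℕ} (ha : a < N) (hb : b < N) (hf : f < N) (ht : t < N)
    (hat : a ≠ t) (hbt : b ≠ t) (hft : f ≠ t) (haf : a ≠ f) (hbf : b ≠ f) :
    Implements N (26 * N + 18) 1 (xorInto t fun x => if x f = 1 then x b else x a) := by
  have e : ∀ u v w : Fin 2, (if u = 1 then w else v) = v + v * u + w * u := by decide
  simp only [e]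
  refine (((implements_cnot ha ht hat).xorInto_add
    (implements_toffoli ha hf ht haf hat hft) ?_).xorInto_add
    (implements_toffoli hb hf ht hbf hbt hft) ?_).mono (by omega) <;>
    simp [Function.update_of_ne, hat, hbt, hft]

/-- Each step reads the carry just written and adds into a wire that is still zero, so the addition
amounts to an assignment. -/
theorem runUp_carryBit {α β c : ℕ → ℕ} {w : ℕ}
    (hα : ∀ k < w, ∀ l < w, α k ≠ c (l + 1)) (hβ : ∀ k < w, ∀ l < w, β k ≠ c (l + 1))
    (hc : ∀ k ≤ w, ∀ l ≤ w, c k = c l → k = l) (x : ℕ → Fin 2) (hx : ∀ k ≤ w, x (c k) = 0)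
    (k : ℕ) (hk : k ≤ w) :
    (∀ j, (∀ l < k, j ≠ c (l + 1)) → runUp (fun k => xorInto (c (k + 1)) fun x =>
      carryBit (x (α k)) (x (β k)) (x (c k))) k x j = x j) ∧
    ∀ l ≤ k, runUp (fun k => xorInto (c (k + 1)) fun x =>
      carryBit (x (α k)) (x (β k)) (x (c k))) k x (c l) =
        carry (fun k => x (α k)) (fun k => x (β k)) l := by
  induction k with
  | zero =>
    refine ⟨fun j _ => rfl, fun l hl => ?_⟩
    obtain rfl : l = 0 := by omega
    exact hx 0 (by omega)
  | succ k ih =>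
    obtain ⟨ih1, ih2⟩ := ih (by omega)
    simp only [runUp, Function.comp_apply]
    refine ⟨fun j hj => ?_, fun l hl => ?_⟩
    · rw [xorInto, Function.update_of_ne (hj k (by omega))]
      exact ih1 j fun l hl => hj l (by omega)
    · rcases Nat.lt_or_ge k l with h | h
      · obtain rfl : l = k + 1 := by omega
        rw [xorInto, Function.update_self, ih2 k le_rfl,
          ih1 (α k) fun l hl => hα k (by omega) l (by omega),
          ih1 (β k) fun l hl => hβ k (by omega) l (by omega),
          ih1 (c (k + 1)) fun l hl h => by have := hc _ (by omega) _ (by omega) h; omega,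
          hx _ (by omega), zero_add]
        rfl
      · rw [xorInto, Function.update_of_ne, ih2 l h]
        intro h'
        have := hc _ (by omega) _ (by omega) h'
        omega

/-- No step reads a wire that any step writes, so all of them act on the original input. -/
theorem runUp_xorInto {t : ℕ → ℕ} {g : ℕ → (ℕ → Fin 2) → Fin 2} {w : ℕ}
    (ht : ∀ k < w, ∀ l < w, t k = t l → k = l)
    (hg : ∀ k < w, ∀ l < w, ∀ x u, g k (update x (t l) u) = g k x) (x : ℕ → Fin 2)
    (k : ℕ) (hk : k ≤ w) :
    (∀ j, (∀ l < k, j ≠ t l) → runUp (fun k => xorInto (t k) (g k)) k x j = x j) ∧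
    (∀ l < k, runUp (fun k => xorInto (t k) (g k)) k x (t l) = x (t l) + g l x) ∧
    ∀ l < w, g l (runUp (fun k => xorInto (t k) (g k)) k x) = g l x := by
  induction k with
  | zero => exact ⟨fun j _ => rfl, fun l hl => absurd hl (by omega), fun l _ => rfl⟩
  | succ k ih =>
    obtain ⟨ih1, ih2, ih3⟩ := ih (by omega)
    simp only [runUp, Function.comp_apply]
    refine ⟨fun j hj => ?_, fun l hl => ?_, fun l hl => ?_⟩
    · rw [xorInto, Function.update_of_ne (hj k (by omega))]
      exact ih1 j fun l hl => hj l (by omega)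
    · rcases Nat.lt_or_ge l k with h | h
      · rw [xorInto, Function.update_of_ne, ih2 l h]
        intro h'
        have := ht _ (by omega) _ (by omega) h'
        omega
      · obtain rfl : l = k := by omega
        rw [xorInto, Function.update_self, ih3 l (by omega), ih1]
        intro i hi h'
        have := ht _ (by omega) _ (by omega) h'
        omega
    · rw [xorInto, hg l hl k (by omega), ih3 l hl]

/-- Compare the numbers on the wires `α` and `β`, store the result on the wire `f`, and copy
the wires `a` or `b` to the wires `c (k + 1)`, according to the result. -/
theorem exists_implements_selection {N w : ℕ} {α β a b c : ℕ → ℕ} {f : ℕ}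
    (hαN : ∀ k < w, α k < N) (hβN : ∀ k < w, β k < N) (haN : ∀ k < w, a k < N)
    (hbN : ∀ k < w, b k < N) (hcN : ∀ k ≤ w, c k < N) (hfN : f < N)
    (hα : ∀ k < w, ∀ l ≤ w, α k ≠ c l) (hβ : ∀ k < w, ∀ l ≤ w, β k ≠ c l)
    (ha : ∀ k < w, ∀ l < w, a k ≠ c (l + 1)) (hb : ∀ k < w, ∀ l < w, b k ≠ c (l + 1))
    (hαβ : ∀ k < w, α k ≠ β k)
    (hc : ∀ k ≤ w, ∀ l ≤ w, c k = c l → k = l)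
    (hαf : ∀ k < w, α k ≠ f) (hβf : ∀ k < w, β k ≠ f) (haf : ∀ k < w, a k ≠ f)
    (hbf : ∀ k < w, b k ≠ f) (hcf : ∀ k ≤ w, c k ≠ f) :
    ∃ F, Implements N (w * (106 * N + 72) + 2 * N) 1 F ∧
      ∀ x : ℕ → Fin 2, (∀ k ≤ w, x (c k) = 0) → x f = 0 →
        (∀ k < w, F x (c (k + 1)) =
          if carry (fun k => x (α k)) (fun k => x (β k)) w = 1 then x (b k) else x (a k)) ∧
        ∀ j, j ≠ f → (∀ k < w, j ≠ c (k + 1)) → F x j = x j := by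
  set C : ℕ → (ℕ → Fin 2) → ℕ → Fin 2 := fun k => xorInto (c (k + 1)) fun x =>
      carryBit (x (α k)) (x (β k)) (x (c k)) with hC
  set S : ℕ → (ℕ → Fin 2) → ℕ → Fin 2 := fun k => xorInto (c (k + 1)) fun x =>
      if x f = 1 then x (b k) else x (a k) with hS
  have hcc : ∀ k < w, c k ≠ c (k + 1) := fun k hk h => by
    have := hc _ (by omega) _ (by omega) h; omega
  have iC : ∀ k < w, Implements N (40 * N + 27) 1 (C k) := fun k hk =>
    implements_carryBit (hαN k hk) (hβN k hk) (hcN k (by omega)) (hcN _ hk) (hα k hk _ hk)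
      (hβ k hk _ hk) (hcc k hk) (hαβ k hk) (hα k hk k (by omega)) (hβ k hk k (by omega))
  have iS : ∀ k < w, Implements N (26 * N + 18) 1 (S k) := fun k hk =>
    implements_select (haN k hk) (hbN k hk) hfN (hcN _ hk) (ha k hk _ hk) (hb k hk _ hk)
      (hcf _ hk).symm (haf k hk) (hbf k hk)
  -- Carries up, flag, carries down, selection: `2w` carry steps, `w` selections and one CNOT, hence
  -- `2 * 40 + 26 = 106` and `2 * 27 + 18 = 72`.
  refine ⟨_, (((Implements.runUp w iS).comp (Implements.runDown w iC)).comp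
    ((implements_cnot (hcN w le_rfl) hfN (hcf w le_rfl)).comp (Implements.runUp w iC))).mono
    (by nlinarith), fun x hx hxf => ?_⟩
  obtain ⟨h1, h2⟩ := runUp_carryBit (fun k hk l hl => hα k hk _ hl) (fun k hk l hl => hβ k hk _ hl)
    hc x hx w le_rfl
  have h2 := h2 w le_rfl
  have hf : ∀ l < w, f ≠ c (l + 1) := fun l hl => (hcf _ hl).symm
  have h1 := h1 f hf
  rw [← hC] at h1 h2
  -- After the carries are undone, the flag is the only wire that has changed.
  have key : runDown C w (xorInto f (fun x => x (c w)) (runUp C w x)) =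
      update x f (carry (fun k => x (α k)) (fun k => x (β k)) w) := by
    rw [xorInto, h1, h2, hxf, zero_add]
    apply runDown_update_runUp
    · intro l hl x
      refine xorInto_xorInto (fun x u => ?_) x
      rw [Function.update_of_ne (hα l hl _ hl), Function.update_of_ne (hβ l hl _ hl),
        Function.update_of_ne (hcc l hl)]
    · intro l hl x
      simp only [hC, xorInto]
      rw [Function.update_of_ne (hαf l hl), Function.update_of_ne (hβf l hl),
        Function.update_of_ne (hcf l (by omega)), Function.update_of_ne (hcf _ hl),
        Function.update_comm (hcf _ hl).symm]
  simp only [Function.comp_apply, key]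
  generalize carry (fun k => x (α k)) (fun k => x (β k)) w = v
  obtain ⟨s1, s2, -⟩ := runUp_xorInto (t := fun k => c (k + 1)) (w := w)
    (g := fun k x => if x f = 1 then x (b k) else x (a k))
    (fun k hk l hl h => by have := hc _ (by omega) _ (by omega) h; omega)
    (fun k hk l hl x u => by
      rw [Function.update_of_ne (hf l hl), Function.update_of_ne (hb k hk l hl),
        Function.update_of_ne (ha k hk l hl)]) (update x f v) w le_rfl
  refine ⟨fun k hk => ?_, fun j hj hjc => ?_⟩
  · refine (s2 k hk).trans ?_
    rw [Function.update_of_ne (hcf _ hk), hx _ hk, Function.update_self,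
      Function.update_of_ne (haf k hk), Function.update_of_ne (hbf k hk), zero_add]
  · refine (s1 j hjc).trans ?_
    rw [Function.update_of_ne hj]

/-! ### Arithmetic of the two's complement representation -/

theorem exists_eq_restrict {N : ℕ} (x : Bits N) : ∃ X : ℕ → Fin 2, restrict N X = x :=
  ⟨fun j => if h : j < N then x ⟨j, h⟩ else 0, by ext1 j; simp⟩

/-- The contribution of the bit `b` at the position `p`. -/
def bitValue (n : ℕ) (b : Fin 2) (p : ℕ) : ℚ :=
  (if p = 0 then (-1 : ℚ) else 1) * ((b : ℕ) : ℚ) * (2 : ℚ) ^ ((n : ℤ) - 1 - (p : ℤ))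

theorem decode_restrict (n m : ℕ) (X : ℕ → Fin 2) :
    decode n m (restrict (n + m) X) = ∑ p ∈ Finset.range (n + m), bitValue n (X p) p := by
  rw [← Fin.sum_univ_eq_sum_range fun p => bitValue n (X p) p]
  rfl

/-- The sign bit is not in the tail, so the remaining bits form a nonnegative binary fraction
smaller than the weight of position `p`. The induction adds bits from the last position backwards.
-/
theorem sum_bitValue_tail (n N : ℕ) (X : ℕ → Fin 2) (d p : ℕ) (h : p + 1 + d = N) :
    0 ≤ ∑ q ∈ Finset.range N, bitValue n (X q) q -
        ∑ q ∈ Finset.range (p + 1), bitValue n (X q) q ∧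
      ∑ q ∈ Finset.range N, bitValue n (X q) q -
        ∑ q ∈ Finset.range (p + 1), bitValue n (X q) q < (2 : ℚ) ^ ((n : ℤ) - 1 - (p : ℤ)) := by
  induction d generalizing p with
  | zero =>
    obtain rfl : p + 1 = N := h
    rw [sub_self]
    exact ⟨le_rfl, by positivity⟩
  | succ d ih =>
    obtain ⟨h1, h2⟩ := ih (p + 1) (by omega)
    rw [Finset.sum_range_succ _ (p + 1)] at h1 h2
    have e : (2 : ℚ) ^ ((n : ℤ) - 1 - (p : ℤ)) =
        2 * (2 : ℚ) ^ ((n : ℤ) - 1 - ((p + 1 : ℕ) : ℤ)) := by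
      rw [← zpow_one_add₀ two_ne_zero]; congr 1; push_cast; ring
    rw [e]
    have hpos : (0 : ℚ) < (2 : ℚ) ^ ((n : ℤ) - 1 - ((p + 1 : ℕ) : ℤ)) := by positivity
    have two : ∀ u : Fin 2, u = 0 ∨ u = 1 := by decide
    rw [bitValue, if_neg (by omega)] at h1 h2
    rcases two (X (p + 1)) with h0 | h0 <;> simp only [h0, Fin.val_zero, Fin.val_one] at h1 h2 <;>
      constructor <;> push_cast at * <;> linarith

/-- By the tail bound, the greedy test at a position succeeds exactly when the bit there is 1, so
the encoder's prefix stays equal to the partial sum. -/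
theorem encode_decode (n m : ℕ) (x : Bits (n + m)) : encode n m (decode n m x) = x := by
  obtain ⟨X, rfl⟩ := exists_eq_restrict x
  rw [decode_restrict]
  have tail := fun p (hp : p < n + m) =>
    sum_bitValue_tail n (n + m) X (n + m - (p + 1)) p (by omega)
  generalize ∑ q ∈ Finset.range (n + m), bitValue n (X q) q = y at tail
  have two : ∀ u : Fin 2, u = 0 ∨ u = 1 := by decide
  have key : ∀ p < n + m,
      encodePrefix n y p = ∑ q ∈ Finset.range (p + 1), bitValue n (X q) q ∧
        encodeBit n y p = X p := by
    intro p
    induction p with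
    | zero =>
      intro hp
      obtain ⟨h1, h2⟩ := tail 0 hp
      simp only [encodePrefix, encodeBit]
      simp only [zero_add, Finset.sum_range_one, bitValue, if_true] at h1 h2 ⊢
      push_cast at h1 h2 ⊢
      rw [sub_zero] at h1 h2 ⊢
      rcases two (X 0) with h0 | h0 <;> simp only [h0, Fin.val_zero, Fin.val_one] at h1 h2 ⊢
      · rw [if_neg (by push_cast at h1; linarith), if_neg (by push_cast at h1; linarith)]
        simp
      · rw [if_pos (by push_cast at h2; linarith), if_pos (by push_cast at h2; linarith)]
        simp
    | succ p ih =>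
      intro hp
      obtain ⟨h1, h2⟩ := tail (p + 1) hp
      obtain ⟨ih, -⟩ := ih (by omega)
      simp only [encodePrefix, encodeBit, ih]
      rw [Finset.sum_range_succ _ (p + 1)] at h1 h2 ⊢
      generalize ∑ q ∈ Finset.range (p + 1), bitValue n (X q) q = s at *
      have hb : bitValue n (X (p + 1)) (p + 1) =
          1 * ((X (p + 1) : ℕ) : ℚ) * (2 : ℚ) ^ ((n : ℤ) - 1 - ((p + 1 : ℕ) : ℤ)) := by
        rw [bitValue, if_neg (by omega)]
      rw [hb] at h1 h2 ⊢
      generalize (2 : ℚ) ^ ((n : ℤ) - 1 - ((p + 1 : ℕ) : ℤ)) = e at *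
      rcases two (X (p + 1)) with h0 | h0 <;>
        simp only [h0, Fin.val_zero, Fin.val_one] at h1 h2 ⊢ <;> push_cast at h1 h2 ⊢
      · rw [if_neg (by linarith), if_neg (by linarith)]
        simp
      · rw [if_pos (by linarith), if_pos (by linarith)]
        simp
  ext1 p
  exact (key p p.2).2

/-- The bound on the low difference lets differing top bits decide its sign. Stating both
alternatives, `1 ≤ D` and `D ≤ 0`, carries the integrality of the rational sum `D` through the
induction. -/
theorem carry_eq_one_iff (α β : ℕ → Fin 2) (k : ℕ) :
    |∑ j ∈ Finset.range k, (((β j : ℕ) : ℚ) - ((α j : ℕ) : ℚ)) * 2 ^ j| ≤ 2 ^ k - 1 ∧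
      (carry α β k = 1 ↔
        1 ≤ ∑ j ∈ Finset.range k, (((β j : ℕ) : ℚ) - ((α j : ℕ) : ℚ)) * 2 ^ j) ∧
      (carry α β k = 0 ↔
        ∑ j ∈ Finset.range k, (((β j : ℕ) : ℚ) - ((α j : ℕ) : ℚ)) * 2 ^ j ≤ 0) := by
  induction k with
  | zero => simp [carry]
  | succ k ih =>
    rw [Finset.sum_range_succ]
    generalize ∑ j ∈ Finset.range k, (((β j : ℕ) : ℚ) - ((α j : ℕ) : ℚ)) * 2 ^ j = D at *
    obtain ⟨h1, h2, h3⟩ := ih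
    have hp : (1 : ℚ) ≤ 2 ^ k := one_le_pow₀ (by norm_num)
    rw [abs_le] at *
    have two : ∀ u : Fin 2, u = 0 ∨ u = 1 := by decide
    rw [carry]
    generalize carry α β k = c at *
    rw [pow_succ]
    rcases two (α k) with ha | ha <;> rcases two (β k) with hb | hb <;>
      rcases two c with rfl | rfl <;> simp [ha, hb, carryBit] at h2 h3 ⊢ <;>
      refine ⟨⟨?_, ?_⟩, ?_⟩ <;> try constructor
    all_goals linarith

/-- The comparison of two encoded numbers: the sign bits exchange their roles. -/
theorem decode_lt_iff_carry (n m : ℕ) (X Y : ℕ → Fin 2) :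
    decode n m (restrict (n + m) X) < decode n m (restrict (n + m) Y) ↔
      carry (fun k => if k = n + m - 1 then Y (n + m - 1 - k) else X (n + m - 1 - k))
        (fun k => if k = n + m - 1 then X (n + m - 1 - k) else Y (n + m - 1 - k)) (n + m) = 1 := by
  rw [← sub_pos, decode_restrict, decode_restrict, ← Finset.sum_sub_distrib,
    ← Finset.sum_range_reflect]
  set α : ℕ → Fin 2 := fun k => if k = n + m - 1 then Y (n + m - 1 - k) else X (n + m - 1 - k)
    with hα
  set β : ℕ → Fin 2 := fun k => if k = n + m - 1 then X (n + m - 1 - k) else Y (n + m - 1 - k)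
    with hβ
  -- Index `k` now counts from the lowest bit, with weight `2 ^ (k - m)`; exchanging the sign bits
  -- absorbs their negative weight.
  have e : ∑ j ∈ Finset.range (n + m), (bitValue n (Y (n + m - 1 - j)) (n + m - 1 - j) -
      bitValue n (X (n + m - 1 - j)) (n + m - 1 - j)) = (2 : ℚ) ^ (-(m : ℤ)) *
        ∑ j ∈ Finset.range (n + m), (((β j : ℕ) : ℚ) - ((α j : ℕ) : ℚ)) * 2 ^ j := by
    rw [Finset.mul_sum]
    refine Finset.sum_congr rfl fun k hk => ?_
    rw [Finset.mem_range] at hk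
    have e : (2 : ℚ) ^ ((n : ℤ) - 1 - ((n + m - 1 - k : ℕ) : ℤ)) =
        (2 : ℚ) ^ (-(m : ℤ)) * 2 ^ k := by
      rw [← zpow_natCast, ← zpow_add₀ two_ne_zero]; congr 1; omega
    simp only [bitValue, e, hα, hβ]
    by_cases h : k = n + m - 1
    · simp only [if_pos h, if_pos (show n + m - 1 - k = 0 by omega)]; ring
    · simp only [if_neg h, if_neg (show ¬ n + m - 1 - k = 0 by omega)]; ring
  rw [e, mul_pos_iff_of_pos_left (by positivity)]
  obtain ⟨-, h2, h3⟩ := carry_eq_one_iff α β (n + m)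
  have two : ∀ u : Fin 2, u = 0 ∨ u = 1 := by decide
  rcases two (carry α β (n + m)) with h | h
  · have := h3.1 h
    rw [h]
    simpa using this
  · have := h2.1 h
    simp only [h, iff_true]
    linarith

/-! ### The maximum of several registers -/

theorem tensorState_ket_restrict (p q : ℕ) (x : ℕ → Fin 2) :
    tensorState (ket (restrict p x)) (ket (restrict q fun j => x (p + j))) =
      ket (restrict (p + q) x) := by
  ext y
  simp only [tensorState, ket_apply, ← ite_and, mul_ite, mul_one, mul_zero]
  refine if_congr ⟨?_, ?_⟩ rfl rfl
  · rintro ⟨h2, h1⟩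
    ext1 j
    refine Fin.addCases (fun j => ?_) (fun j => ?_) j
    · exact congrFun h1 j
    · exact congrFun h2 j
  · rintro rfl
    exact ⟨rfl, rfl⟩

theorem castState_ket_restrict {p q : ℕ} (h : p = q) (x : ℕ → Fin 2) :
    castState h (ket (restrict p x)) = ket (restrict q x) := by
  subst h; rfl

theorem isNormalized_ket {n : ℕ} (x : Bits n) : IsNormalized (ket x) := by
  simp only [IsNormalized, ket_apply]
  rw [Finset.sum_eq_single x] <;> simp +contextual

/-- One comparison: replace the number on the wires `A + p` by its maximum with the number on the
wires `R + p`, using fresh wires from `B` on. -/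
theorem exists_implements_max {N n m A R B : ℕ} (hw : 0 < n + m) (hA : A + (n + m) ≤ B)
    (hR : R + (n + m) ≤ B) (hAR : A + (n + m) ≤ R ∨ R + (n + m) ≤ A)
    (hB : B + (n + m + 4) ≤ N) :
    ∃ F, Implements N ((n + m) * (106 * N + 72) + 2 * N) 1 F ∧
      ∀ x : ℕ → Fin 2, (∀ j ≥ B, x j = 0) →
        (∀ j < B, F x j = x j) ∧ (∀ j ≥ B + (n + m + 4), F x j = 0) ∧
        ∀ p < n + m, F x (B + 4 + p) =
          if decode n m (restrict (n + m) fun p => x (A + p)) <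
            decode n m (restrict (n + m) fun p => x (R + p)) then x (R + p) else x (A + p) := by
  -- In the block from `B`, the flag is `B`, the initial zero carry is `B + 1`, and `B + 2`, `B + 3`
  -- stay idle. The carry wires run backwards through the last `n + m` places, so that `c (k + 1)`
  -- is the place of the output bit of weight index `k`.
  obtain ⟨F, hF, hFx⟩ := exists_implements_selection (N := N) (w := n + m)
    (α := fun k => if k = n + m - 1 then R + (n + m - 1 - k) else A + (n + m - 1 - k))
    (β := fun k => if k = n + m - 1 then A + (n + m - 1 - k) else R + (n + m - 1 - k))
    (a := fun k => A + (n + m - 1 - k)) (b := fun k => R + (n + m - 1 - k))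
    (c := fun k => if k = 0 then B + 1 else B + 4 + (n + m - k)) (f := B)
    (by intros; split_ifs <;> omega) (by intros; split_ifs <;> omega)
    (by intros; omega) (by intros; omega) (by intros; split_ifs <;> omega) (by omega)
    (by intros; split_ifs <;> omega) (by intros; split_ifs <;> omega)
    (by intros; split_ifs <;> omega) (by intros; split_ifs <;> omega)
    (by intros; split_ifs <;> omega) (by intro k _ l _; split_ifs <;> omega)
    (by intros; split_ifs <;> omega) (by intros; split_ifs <;> omega)
    (by intros; omega) (by intros; omega) (by intros; split_ifs <;> omega)
  refine ⟨F, hF, fun x hx => ?_⟩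
  obtain ⟨h1, h2⟩ := hFx x (fun k hk => hx _ (by split_ifs <;> omega)) (hx _ le_rfl)
  refine ⟨fun j hj => h2 j (by omega) fun k hk => by rw [if_neg (by omega)]; omega, fun j hj => ?_,
    fun p hp => ?_⟩
  · rw [h2 j (by omega) fun k hk => by rw [if_neg (by omega)]; omega, hx j (by omega)]
  · have := h1 (n + m - 1 - p) (by omega)
    rw [if_neg (by omega), show n + m - (n + m - 1 - p + 1) = p by omega,
      show n + m - 1 - (n + m - 1 - p) = p by omega] at this
    rw [this]
    refine if_congr ?_ rfl rfl
    rw [decode_lt_iff_carry]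
    simp only [apply_ite x]

/-- After `s` comparisons the current maximum sits at the end of block `s`, or in the first input
when `s = 0`. It is kept as a copy of an actual input, and all later blocks are still zero. -/
theorem exists_implements_running_max (I n m : ℕ) (hw : 0 < n + m) (s : ℕ) (hs : s + 1 ≤ I) :
    ∃ F, Implements (I * (n + m) + (I - 1) * (n + m + 4))
        (s * ((n + m) * (106 * (I * (n + m) + (I - 1) * (n + m + 4)) + 72) +
          2 * (I * (n + m) + (I - 1) * (n + m + 4)))) 1 F ∧
      ∀ (i : Fin I → Bits (n + m)) (x : ℕ → Fin 2),
        (∀ (l : Fin I) (p : Fin (n + m)), x ((l : ℕ) * (n + m) + (p : ℕ)) = i l p) → (∀ j ≥ I * (n + m), x j = 0) →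
        (∀ j < I * (n + m), F x j = x j) ∧
        (∀ j ≥ I * (n + m) + s * (n + m + 4), F x j = 0) ∧
        ∃ l : Fin I, (∀ l' : Fin I, (l' : ℕ) ≤ s → decode n m (i l') ≤ decode n m (i l)) ∧
          ∀ p : Fin (n + m), F x ((if s = 0 then 0 else
            I * (n + m) + (s - 1) * (n + m + 4) + 4) + p) = i l p := by
  induction s with
  | zero =>
    refine ⟨id, (Implements.id _).mono (Nat.zero_le _), fun i x hi hx =>
      ⟨fun j _ => rfl, fun j hj => hx j (by simpa using hj), ⟨0, by omega⟩, ?_, fun p => ?_⟩⟩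
    · intro l' hl'
      rw [show l' = ⟨0, by omega⟩ from Fin.ext (by simpa using hl')]
    · simpa using hi ⟨0, by omega⟩ p
  | succ s ih =>
    obtain ⟨F, hF, hFx⟩ := ih (by omega)
    have hI : (s + 1) * (n + m) + (n + m) ≤ I * (n + m) := by
      rw [← Nat.succ_mul]; exact Nat.mul_le_mul_right _ hs
    have hN : I * (n + m) + s * (n + m + 4) + (n + m + 4) ≤
        I * (n + m) + (I - 1) * (n + m + 4) := by
      rw [add_assoc, ← Nat.succ_mul]
      exact Nat.add_le_add_left (Nat.mul_le_mul_right _ (by omega)) _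
    set A := if s = 0 then 0 else I * (n + m) + (s - 1) * (n + m + 4) + 4 with hA
    -- The current maximum is the first input or ends just where the fresh block begins.
    have hA' : A = 0 ∧ s = 0 ∨
        I * (n + m) ≤ A ∧ A + (n + m) = I * (n + m) + s * (n + m + 4) := by
      rcases s with _ | s
      · exact Or.inl ⟨rfl, rfl⟩
      · right
        rw [hA, if_neg (by omega), Nat.add_sub_cancel, Nat.succ_mul]
        omega
    have hR : n + m ≤ (s + 1) * (n + m) := Nat.le_mul_of_pos_left _ (by omega)
    obtain ⟨G, hG, hGx⟩ := exists_implements_max (A := A) (R := (s + 1) * (n + m)) hw (by omega)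
      (by omega) (by omega) hN
    refine ⟨G ∘ F, (hG.comp hF).mono (by rw [Nat.succ_mul s, Nat.add_comm]), fun i x hi hx => ?_⟩
    obtain ⟨f1, f2, l, hl, hlp⟩ := hFx i x hi hx
    obtain ⟨g1, g2, g3⟩ := hGx (F x) f2
    have eX : restrict (n + m) (fun p => F x (A + p)) = i l := funext hlp
    have eY : restrict (n + m) (fun p => F x ((s + 1) * (n + m) + p)) = i ⟨s + 1, hs⟩ := by
      ext1 p
      have hp := p.2
      rw [restrict_apply, f1 _ (by omega)]
      exact hi ⟨s + 1, hs⟩ p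
    rw [eX, eY] at g3
    refine ⟨fun j hj => (g1 j (by omega)).trans (f1 j hj), fun j hj => g2 j ?_, ?_⟩
    · rw [Nat.succ_mul] at hj; omega
    · rw [if_neg (by omega), Nat.add_sub_cancel]
      have hle : ∀ l' : Fin I, (l' : ℕ) ≤ s + 1 →
          decode n m (i l') ≤ decode n m (i l) ∨ l' = ⟨s + 1, hs⟩ := by
        intro l' hl'
        rcases Nat.lt_or_ge s l' with h | h
        · exact Or.inr (Fin.ext (by simp; omega))
        · exact Or.inl (hl l' h)
      by_cases h : decode n m (i l) < decode n m (i ⟨s + 1, hs⟩)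
      · refine ⟨⟨s + 1, hs⟩, fun l' hl' => ?_, fun p => ?_⟩
        · rcases hle l' hl' with h' | rfl
          · exact h'.trans h.le
          · exact le_rfl
        · refine (g3 p p.2).trans ?_
          rw [if_pos h]
          exact congrFun eY p
      · refine ⟨l, fun l' hl' => ?_, fun p => ?_⟩
        · rcases hle l' hl' with h' | rfl
          · exact h'
          · exact not_lt.1 h
        · refine (g3 p p.2).trans ?_
          rw [if_neg h]
          exact congrFun eX p

/-- With `N + 1 ≤ I * (2 * w + 4)`, the spare 1 absorbs the 72, and the count is at most `I ^ 2 *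
(106 * w + 2) * (2 * w + 4)`, which is only quadratic in `w`. -/
theorem gate_count_le (I w : ℕ) (hI : 2 ≤ I) (hw : 2 ≤ w) :
    (I - 1) * (w * (106 * (I * w + (I - 1) * (w + 4)) + 72) +
      2 * (I * w + (I - 1) * (w + 4))) ≤ 657 * I ^ 2 * (w + 1) ^ 3 := by
  obtain ⟨k, rfl⟩ : ∃ k, I = k + 2 := ⟨I - 2, by omega⟩
  obtain ⟨v, rfl⟩ : ∃ v, w = v + 2 := ⟨w - 2, by omega⟩
  rw [show k + 2 - 1 = k + 1 by omega]
  have h1 : (k + 2) * (v + 2) + (k + 1) * (v + 2 + 4) + 1 ≤ (k + 2) * (2 * (v + 2) + 4) := by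
    nlinarith
  generalize (k + 2) * (v + 2) + (k + 1) * (v + 2 + 4) = N at h1 ⊢
  calc (k + 1) * ((v + 2) * (106 * N + 72) + 2 * N)
      ≤ (k + 2) * ((v + 2) * (106 * ((k + 2) * (2 * (v + 2) + 4))) +
          2 * ((k + 2) * (2 * (v + 2) + 4))) := by
        gcongr <;> omega
    _ = (k + 2) ^ 2 * ((106 * (v + 2) + 2) * (2 * (v + 2) + 4)) := by ring
    _ ≤ (k + 2) ^ 2 * (657 * (v + 2 + 1) ^ 3) := by
        refine Nat.mul_le_mul_left _ ?_
        nlinarith [Nat.zero_le (v ^ 3), Nat.zero_le (v ^ 2)]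
    _ = _ := by ring

end QuantumMax

theorem corollary3 (I n m : ℕ) (hI : 2 ≤ I) (hn : 1 ≤ n) (hm : 1 ≤ m) :
    ∃ (Q : Operator (I * (n + m) + (I - 1) * (n + m + 4))) (M : ℕ),
      IsQuantumCircuit (I * (n + m) + (I - 1) * (n + m + 4)) Q M ∧
      M ≤ 657 * I ^ 2 * (n + m + 1) ^ 3 ∧
      ∀ i : Fin I → Bits (n + m),
        ∃ anc : State ((I - 2) * (n + m) + 4 * (I - 1)), IsNormalized anc ∧
          Q.mulVec (tensorState (ket (concat i)) (ket (0 : Bits ((I - 1) * (n + m + 4))))) =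
            castState (width_eq hI (n + m))
              (tensorState (ket (concat i))
                (tensorState anc (ket (maxString (Nat.lt_of_lt_of_le Nat.zero_lt_two hI) i)))) := by
  obtain ⟨F, ⟨Q, M, hQ, hM, hQx⟩, hF⟩ :=
    exists_implements_running_max I n m (by omega) (I - 1) (by omega)
  refine ⟨Q, M, hQ, hM.trans (gate_count_le I (n + m) hI (by omega)), fun i => ?_⟩
  obtain ⟨x, hx⟩ := exists_eq_restrict (concat i)
  have hxi : ∀ (l : Fin I) (p : Fin (n + m)), x ((l : ℕ) * (n + m) + (p : ℕ)) = i l p := by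
    intro l p
    have := congrFun hx (finProdFinEquiv (l, p))
    have e : concat i (finProdFinEquiv (l, p)) = i l p := by
      have h := finProdFinEquiv.symm_apply_apply (l, p)
      rw [finProdFinEquiv_symm_apply, Prod.mk.injEq] at h
      rw [concat, h.1, h.2]
    rw [e] at this
    rw [← this, restrict_apply, finProdFinEquiv_apply_val]
    congr 1
    ring
  set z : ℕ → Fin 2 := fun j => if j < I * (n + m) then x j else 0 with hz
  have hzx : restrict (I * (n + m)) z = concat i := by
    rw [← hx]
    ext1 j
    simp [hz]
  have hzi : ∀ (l : Fin I) (p : Fin (n + m)), z ((l : ℕ) * (n + m) + (p : ℕ)) = i l p := by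
    intro l p
    have h : (l + 1) * (n + m) ≤ I * (n + m) := Nat.mul_le_mul_right _ l.2
    have hp := p.2
    rw [Nat.succ_mul] at h
    rw [← hxi, hz]
    exact if_pos (by omega)
  obtain ⟨h1, -, l, hl, hlp⟩ := hF i z hzi fun j hj => if_neg (by omega)
  have hmax : maxString (Nat.lt_of_lt_of_le Nat.zero_lt_two hI) i = i l := by
    rw [maxString, ← encode_decode n m (i l)]
    congr 1
    refine le_antisymm (Finset.sup'_le _ _ fun l' _ => hl l' (by omega)) ?_
    exact Finset.le_sup' (fun l => decode n m (i l)) (Finset.mem_univ l)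
  refine ⟨ket (restrict _ fun j => F z (I * (n + m) + j)), isNormalized_ket _, ?_⟩
  have e0 : (0 : Bits ((I - 1) * (n + m + 4))) = restrict _ fun j => z (I * (n + m) + j) := by
    ext1 j
    simp [hz]
  have e1 : concat i = restrict (I * (n + m)) (F z) := by
    rw [← hzx]
    ext1 j
    exact (h1 j j.2).symm
  have e2 : i l = restrict (n + m) fun j =>
      F z (I * (n + m) + ((I - 2) * (n + m) + 4 * (I - 1) + j)) := by
    ext1 p
    rw [← hlp p, restrict_apply, if_neg (by omega)]
    congr 1
    -- Block `I - 1` starts after `I - 2` blocks of `n + m + 4` wires, and its output after 4 more,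
    -- which is exactly the ancilla width.
    obtain ⟨k, rfl⟩ := Nat.exists_eq_add_of_le hI
    simp only [show 2 + k - 1 = k + 1 by omega, show 2 + k - 2 = k by omega, Nat.add_sub_cancel]
    ring
  rw [hmax, e2, tensorState_ket_restrict _ _ fun j => F z (I * (n + m) + j), e1,
    tensorState_ket_restrict, castState_ket_restrict, ← e1, ← hzx, e0, tensorState_ket_restrict,
    hQx, Pi.one_apply, one_smul]
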